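/- Let $k$ be an algebraically closed field of characteristic zero; all coalgebras are coassociative, counital and cocommutative $k$-coalgebras. For a finite-dimensional $k$-vector space $V$ of dimension $n$, put $R=\operatorname{Sym}(V^*)$ and, for $P\in V$ with corresponding maximal ideal $\mathfrak m_P\subset R$, $$\mathrm{LC}(V,P)=H^n_{\mathfrak m_P}(R,\Omega^n_{R/k}).$$ Choose a basis $e_1,\dots,e_n$ of $V$, with dual coordinates $x_1,\dots,x_n$, and put $z_i=x_i-P_i$. Then $\mathrm{LC}(V,P)$ has as $k$-basis the generalised fractions $$[\underline a]=\left[\frac{dz_1\wedge\cdots\wedge dz_n}{z_1^{a_1+1},\dots,z_n^{a_n+1}}\right],\qquad \underline a=(a_1,\dots,a_n)\in\mathbb N^n.$$ Let $\operatorname{Res}_P:\mathrm{LC}(V,P)\to k$ be the residue, so $\operatorname{Res}_P[\underline a]=1$ if $\underline a=0$ and $0$ otherwise. Then $\mathrm{LC}(V,P)$ is a coalgebra with counit $\operatorname{Res}_P$ and coproduct $[\underline a]\mapsto\sum_{\underline c+\underline d=\underline a}[\underline c]\otimes[\underline d]$, the transpose under the pairing $(f,\eta)\mapsto\operatorname{Res}_P(f\eta)$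 of the multiplication of $R$. For $\nu\in V$ the directional derivative $\partial_\nu$ of $R$ acts on $\mathrm{LC}(V,P)$ by transposition, $\operatorname{Res}_P(f\cdot\partial_\nu\eta)=\operatorname{Res}_P(\partial_\nu(f)\,\eta)$ for $f\in R$, and for $\nu_1,\dots,\nu_s\in V$ ($s\ge 0$) one sets $$|\nu_1,\dots,\nu_s\rangle_P=\partial_{\nu_1}\cdots\partial_{\nu_s}|0\rangle_P,\qquad |0\rangle_P=[\underline 0]=\left[\frac{dz_1\wedge\cdots\wedge dz_n}{z_1,\dots,z_n}\right].$$ Let ${!}V=\bigoplus_{P\in V}\mathrm{LC}(V,P)$ be the direct sum coalgebra, and let $d_V:{!}V\to V$ be the linear map with $d_V(\eta)=\sum_i\operatorname{Res}_P(x_i\eta)\,e_i$ for $\eta\in\mathrm{LC}(V,P)$. Let $\psi:W\to V$ be a linear map of finite-dimensional $k$-vector spaces. Then, for any choice of bases of $W$ and $V$, there is a unique morphism of coalgebras ${!}\psi:{!}W\to{!}V$ with $d_V\circ{!}\psi=\psi\circ d_W$, and it satisfies $${!}\psi\,|\nu_1,\dots,\nu_s\rangle_P=|\psi(\nu_1),\dots,\psi(\nu_s)\rangle_{\psi(P)}$$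 for all $s\ge0$ and all $P,\nu_1,\dots,\nu_s\in W$. -/

import Mathlib

open scoped TensorProduct
open Module

noncomputable section

namespace Sweedler

/-! ### Top local cohomology through the Čech complex -/

section Cech

variable {R : Type*} [CommRing R] {n : ℕ}

/-- The multiplicative subset of `R` generated by the members of the sequence `t`. -/
def denominators (t : Fin n → R) : Submonoid R :=
  Submonoid.closure (Set.range t)

/-- The image of the last differential
`⨁ i, M_{t 0 ⋯ (omit t i) ⋯ t (n-1)} ⟶ M_{t 0 ⋯ t (n-1)}` of the Čech complex of the module `M`
on the sequence `t`: it is spanned by the fractions whose denominator is a product of members of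
the sequence other than some `t i`. -/
def cechBoundaries (t : Fin n → R) (M : Type*) [AddCommGroup M] [Module R M] :
    Submodule R (LocalizedModule (denominators t) M) :=
  ⨆ i : Fin n, Submodule.span R
    {y | ∃ (m : M) (s : denominators t),
      (s : R) ∈ Submonoid.closure (t '' {j | j ≠ i}) ∧ y = LocalizedModule.mk m s}

/-- The `n`-th Čech cohomology of `M` on a sequence `t` of length `n`, that is the cokernel of the
last differential of the Čech complex.  Over a Noetherian ring this is the local cohomology
`H^n_I(M)` with support in the ideal `I` generated by the sequence. -/
abbrev TopLocalCohomology (t : Fin n → R) (M : Type*) [AddCommGroup M] [Module R M] : Type _ :=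
  LocalizedModule (denominators t) M ⧸ cechBoundaries t M

lemma prod_pow_mem_denominators (t : Fin n → R) (a : Fin n →₀ ℕ) :
    ∏ i, t i ^ a i ∈ denominators t :=
  Submonoid.prod_mem _ fun i _ =>
    Submonoid.pow_mem _ (Submonoid.subset_closure (Set.mem_range_self i)) _

/-- The generalised fraction `[m / t₁ ^ a₁, …, tₙ ^ aₙ]`. -/
def genFrac (t : Fin n → R) {M : Type*} [AddCommGroup M] [Module R M] (m : M) (a : Fin n →₀ ℕ) :
    TopLocalCohomology t M :=
  Submodule.Quotient.mk (LocalizedModule.mk (S := denominators t) m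
    ⟨∏ i, t i ^ a i, prod_pow_mem_denominators t a⟩)

end Cech

universe u v

variable {k : Type u} [Field k] {V : Type v} [AddCommGroup V] [Module k V] {n : ℕ}

/-! ### Polynomial functions, their derivatives and differential forms -/

variable (k V) in
/-- The ring `Sym(V*)` of polynomial functions on `V`. -/
abbrev PolyFun : Type (max u v) := SymmetricAlgebra k (Dual k V)

variable (V) in
/-- A linear form on `V`, as a polynomial function. -/
abbrev linForm (l : Dual k V) : PolyFun k V := SymmetricAlgebra.ι k (Dual k V) l

/-- The value of a polynomial function at the point `P`. -/
def evalAt (P : V) : PolyFun k V →ₐ[k] k :=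
  SymmetricAlgebra.lift (Dual.eval k V P)

/-- The morphism `f ↦ f + ε ∂_ν f` into the dual numbers over `Sym(V*)`. -/
def derivAux (ν : V) : PolyFun k V →ₐ[k] TrivSqZeroExt (PolyFun k V) (PolyFun k V) :=
  SymmetricAlgebra.lift
    { toFun := fun l =>
        TrivSqZeroExt.inl (linForm V l) + TrivSqZeroExt.inr (algebraMap k _ (l ν))
      map_add' := fun l m => by ext <;> simp [linForm, Algebra.algebraMap_eq_smul_one, add_smul]
      map_smul' := fun c l => by
        ext <;> simp [linForm, Algebra.algebraMap_eq_smul_one, mul_smul] }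

lemma derivAux_fst (ν : V) (f : PolyFun k V) : (derivAux ν f).fst = f := by
  have : (TrivSqZeroExt.fstHom k (PolyFun k V) (PolyFun k V)).comp (derivAux ν) =
      AlgHom.id k _ := by
    ext l
    simp [derivAux, linForm]
  exact congr($this f)

/-- The derivative `∂_ν` of polynomial functions on `V` in the direction of `ν`: the derivation
with `∂_ν l = l(ν)` for linear forms `l`. -/
def dirDeriv (ν : V) : Derivation k (PolyFun k V) (PolyFun k V) where
  toFun f := (derivAux ν f).snd
  map_add' f g := by simp
  map_smul' c f := by simp
  map_one_eq_zero' := by simp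
  leibniz' f g := by simp [derivAux_fst, TrivSqZeroExt.snd_mul, mul_comm]

lemma dirDeriv_linForm (ν : V) (l : Dual k V) :
    dirDeriv ν (linForm V l) = algebraMap k _ (l ν) := by
  change (derivAux ν (linForm V l)).snd = _
  simp [derivAux, linForm, Algebra.algebraMap_eq_smul_one]

variable (b : Basis (Fin n) k V) (P : V)

/-- The local coordinates `z_i = x_i - P_i` at the point `P`, where the `x_i` are the coordinate
functions of the basis `b`.  They generate the maximal ideal of `P`. -/
def localCoord (i : Fin n) : PolyFun k V :=
  linForm V (b.coord i) - algebraMap k _ (b.coord i P)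

/-- The module `Ω^n` of differential forms of degree `n` on `V`. -/
abbrev Forms (k : Type u) [Field k] (V : Type v) [AddCommGroup V] [Module k V] (n : ℕ) :
    Type (max u v) :=
  ⋀[PolyFun k V]^n Ω[PolyFun k V⁄k]

/-- The form `dz_1 ∧ ⋯ ∧ dz_n`. -/
def volForm : Forms k V n :=
  exteriorPower.ιMulti (PolyFun k V) n fun i => KaehlerDifferential.D k _ (localCoord b P i)

/-- The linear map `Ω^n ⟶ Sym(V*)` with `dr_1 ∧ ⋯ ∧ dr_n ↦ det (∂ r_i / ∂ x_j)`; it is the inverse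
of `f ↦ f dz_1 ∧ ⋯ ∧ dz_n`. -/
def jacobian : Forms k V n →ₗ[PolyFun k V] PolyFun k V :=
  exteriorPower.alternatingMapLinearEquiv <|
    (Matrix.detRowAlternating (n := Fin n) (R := PolyFun k V)).compLinearMap <|
      LinearMap.pi fun j => (dirDeriv (b j)).liftKaehlerDifferential

lemma dirDeriv_localCoord (i j : Fin n) :
    dirDeriv (b j) (localCoord b P i) = if i = j then 1 else 0 := by
  rw [localCoord, map_sub, dirDeriv_linForm]
  by_cases h : i = j
  · simp [h]
  · simp [h]

lemma jacobian_volForm : jacobian b (volForm b P) = 1 := by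
  rw [jacobian, volForm, exteriorPower.alternatingMapLinearEquiv_apply_ιMulti]
  change Matrix.det _ = 1
  rw [← Matrix.det_one (n := Fin n)]
  congr 1
  ext i j
  simp [Matrix.one_apply, dirDeriv_localCoord]

lemma adjoin_localCoord : Algebra.adjoin k (Set.range (localCoord b P)) = ⊤ := by
  rw [eq_top_iff]
  rintro f -
  induction f using SymmetricAlgebra.induction with
  | algebraMap r => exact Subalgebra.algebraMap_mem _ r
  | mul x y hx hy => exact Subalgebra.mul_mem _ hx hy
  | add x y hx hy => exact Subalgebra.add_mem _ hx hy
  | ι l =>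
    have : l = ∑ i, l (b i) • b.coord i := by
      refine b.ext fun j => ?_
      simp
    rw [this, map_sum]
    refine Subalgebra.sum_mem _ fun i _ => ?_
    rw [map_smul]
    refine Subalgebra.smul_mem _ ?_ _
    have : SymmetricAlgebra.ι k (Dual k V) (b.coord i) =
        localCoord b P i + algebraMap k _ (b.coord i P) := by simp [localCoord, linForm]
    rw [this]
    exact Subalgebra.add_mem _ (Algebra.subset_adjoin ⟨i, rfl⟩) (Subalgebra.algebraMap_mem _ _)

lemma D_mem_span (f : PolyFun k V) : KaehlerDifferential.D k (PolyFun k V) f ∈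
    Submodule.span (PolyFun k V)
      (Set.range fun i => KaehlerDifferential.D k (PolyFun k V) (localCoord b P i)) := by
  have hf : f ∈ Algebra.adjoin k (Set.range (localCoord b P)) := by
    rw [adjoin_localCoord]; trivial
  induction hf using Algebra.adjoin_induction with
  | mem x hx =>
    obtain ⟨i, rfl⟩ := hx
    exact Submodule.subset_span ⟨i, rfl⟩
  | algebraMap r => simp
  | add x y _ _ hx hy => rw [map_add]; exact Submodule.add_mem _ hx hy
  | mul x y _ _ hx hy =>
    rw [Derivation.leibniz]
    exact Submodule.add_mem _ (Submodule.smul_mem _ _ hy) (Submodule.smul_mem _ _ hx)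

/-- The basis `dz_1, …, dz_n` of the module of Kähler differentials. -/
def kaehlerBasis : Basis (Fin n) (PolyFun k V) Ω[PolyFun k V⁄k] :=
  Basis.mk (v := fun i => KaehlerDifferential.D k (PolyFun k V) (localCoord b P i))
    (by
      rw [Fintype.linearIndependent_iff]
      intro g hg j
      have := congr((dirDeriv (b j)).liftKaehlerDifferential $hg)
      simpa [dirDeriv_localCoord] using this)
    (by
      rw [← KaehlerDifferential.span_range_derivation, Submodule.span_le]
      rintro _ ⟨f, rfl⟩
      exact D_mem_span b P f)

lemma jacobian_smul_volForm (ω : Forms k V n) : jacobian b ω • volForm b P = ω := by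
  have : (LinearMap.toSpanSingleton _ _ (volForm b P)) ∘ₗ jacobian b = LinearMap.id := by
    refine exteriorPower.linearMap_ext ?_
    refine Basis.ext_alternating (kaehlerBasis b P) fun v hv => ?_
    obtain ⟨σ, rfl⟩ : ∃ σ : Equiv.Perm (Fin n), v = σ :=
      ⟨Equiv.ofBijective v (Finite.injective_iff_bijective.mp hv), rfl⟩
    have h0 : (fun i => kaehlerBasis b P (σ i)) =
      (fun i => KaehlerDifferential.D k (PolyFun k V) (localCoord b P i)) ∘ σ := by
        ext i; simp [kaehlerBasis]
    rw [h0, AlternatingMap.map_perm, AlternatingMap.map_perm]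
    congr 1
    have := jacobian_volForm b P
    simp only [LinearMap.compAlternatingMap_apply, LinearMap.comp_apply, LinearMap.id_apply]
    change (LinearMap.toSpanSingleton _ _ (volForm b P)) (jacobian b (volForm b P)) = volForm b P
    rw [this]; simp
  exact congr($this ω)

/-! ### The local cohomology of `V` at a point, and residues -/

/-- The local cohomology `LC(V, P) = H^n_{m_P}(Sym(V*), Ω^n)` of `V` at the point `P`, computed by
the Čech complex on the local coordinates at `P` coming from the basis `b`. -/
def LC : Type (max u v) :=
  TopLocalCohomology (localCoord b P) (Forms k V n)

instance : AddCommGroup (LC b P) :=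
  inferInstanceAs (AddCommGroup (TopLocalCohomology (localCoord b P) (Forms k V n)))

instance : Module (PolyFun k V) (LC b P) :=
  inferInstanceAs (Module _ (TopLocalCohomology (localCoord b P) (Forms k V n)))

instance : Module k (LC b P) :=
  Module.compHom _ (algebraMap k (PolyFun k V))

instance : IsScalarTower k (PolyFun k V) (LC b P) :=
  IsScalarTower.of_algebraMap_smul fun _ _ => rfl

/-- The exponent `(1, …, 1)`. -/
def ones (n : ℕ) : Fin n →₀ ℕ := Finsupp.equivFunOnFinite.symm 1

@[simp]
lemma ones_apply (n : ℕ) (i : Fin n) : ones n i = 1 := rfl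

/-- The class in `LC(V, P)` of a meromorphic form. -/
def LC.mk : LocalizedModule (denominators (localCoord b P)) (Forms k V n) →ₗ[PolyFun k V] LC b P :=
  Submodule.mkQ (cechBoundaries (localCoord b P) (Forms k V n))

lemma LC.mk_surjective : Function.Surjective (LC.mk b P) :=
  Submodule.mkQ_surjective _

/-- The generalised fraction `[ω / z_1 ^ a_1, …, z_n ^ a_n]` in `LC(V, P)`. -/
def LC.formFrac (ω : Forms k V n) (a : Fin n →₀ ℕ) : LC b P :=
  genFrac (localCoord b P) ω a

/-- The generalised fraction
`[(1 / z_1 ^ a_1, …, z_n ^ a_n) dz / z] = [dz_1 ∧ ⋯ ∧ dz_n / z_1 ^ (a_1 + 1), …, z_n ^ (a_n + 1)]`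
in `LC(V, P)`. -/
def frac (a : Fin n →₀ ℕ) : LC b P :=
  LC.formFrac b P (volForm b P) (a + ones n)

/-- The ring of Laurent polynomials in the local coordinates at `P`. -/
def Laurent (_b : Basis (Fin n) k V) (_P : V) : Type u := AddMonoidAlgebra k (Fin n → ℤ)

instance : CommRing (Laurent b P) := inferInstanceAs (CommRing (AddMonoidAlgebra k (Fin n → ℤ)))

instance : Algebra k (Laurent b P) :=
  inferInstanceAs (Algebra k (AddMonoidAlgebra k (Fin n → ℤ)))

/-- The Laurent monomial `z ^ e`. -/
def zpow (e : Fin n → ℤ) : Laurent b P := AddMonoidAlgebra.single e (1 : k)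

/-- The coefficient of the Laurent monomial `z ^ e`. -/
def laurentCoeff (e : Fin n → ℤ) : Laurent b P →ₗ[k] k :=
  { toFun := fun p => AddMonoidAlgebra.coeff (R := k) (M := Fin n → ℤ) p e
    map_add' := fun _ _ => rfl
    map_smul' := fun _ _ => rfl }

lemma zpow_zero : zpow b P 0 = 1 := rfl

lemma zpow_add (d e : Fin n → ℤ) : zpow b P (d + e) = zpow b P d * zpow b P e := by
  have := AddMonoidAlgebra.single_mul_single (R := k) d e 1 1
  rw [one_mul] at this
  exact this.symm

lemma laurentCoeff_zpow (d e : Fin n → ℤ) :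
    laurentCoeff b P e (zpow b P d) = if d = e then 1 else 0 := by
  classical
  change AddMonoidAlgebra.coeff (AddMonoidAlgebra.single d (1 : k)) e = _
  simp [Finsupp.single_apply]

lemma laurentCoeff_zpow_mul (d e : Fin n → ℤ) (p : Laurent b P) :
    laurentCoeff b P e (zpow b P d * p) = laurentCoeff b P (e - d) p := by
  have := AddMonoidAlgebra.coeff_single_mul_eq_mul_coeff (R := k) (x := p) (m := d) (r := 1)
    (m₁ := e) (e - d) (fun m' _ => by rw [eq_sub_iff_add_eq, add_comm])
  rw [one_mul] at this
  exact this

/-- The expansion of polynomial functions in the local coordinates: `l ↦ l(P) + ∑ l(e_i) z_i`. -/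
def expansion : PolyFun k V →ₐ[k] Laurent b P :=
  SymmetricAlgebra.lift
    { toFun := fun l => algebraMap k _ (l P) + ∑ i, l (b i) • zpow b P (Pi.single i 1)
      map_add' := fun l m => by
        simp only [LinearMap.add_apply, map_add, add_smul, Finset.sum_add_distrib]; ring
      map_smul' := fun c l => by
        simp only [LinearMap.smul_apply, smul_eq_mul, map_mul, Algebra.smul_def,
          Finset.mul_sum, mul_add, RingHom.id_apply, mul_assoc] }

instance : Algebra (PolyFun k V) (Laurent b P) := (expansion b P).toRingHom.toAlgebra

lemma algebraMap_eq_expansion (f : PolyFun k V) :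
    algebraMap (PolyFun k V) (Laurent b P) f = expansion b P f := rfl

lemma expansion_localCoord (i : Fin n) :
    expansion b P (localCoord b P i) = zpow b P (Pi.single i 1) := by
  have h : expansion b P (linForm V (b.coord i)) =
      algebraMap k _ (b.coord i P) + ∑ j, b.coord i (b j) • zpow b P (Pi.single j 1) := by
    rw [expansion, linForm, SymmetricAlgebra.lift_ι_apply]; rfl
  rw [localCoord, map_sub, h, AlgHom.commutes, add_sub_cancel_left,
    Finset.sum_eq_single i]
  · simp
  · intro j _ hj
    simp [hj]
  · simp

/-- A product of local coordinates from a set `A` expands to a monomial in them. -/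
lemma expansion_of_mem_closure (A : Set (Fin n)) {s : PolyFun k V}
    (hs : s ∈ Submonoid.closure (localCoord b P '' A)) :
    ∃ e : Fin n → ℤ, expansion b P s = zpow b P e ∧ ∀ i ∉ A, e i = 0 := by
  induction hs using Submonoid.closure_induction with
  | mem x hx =>
    obtain ⟨i, hi, rfl⟩ := hx
    refine ⟨Pi.single i 1, expansion_localCoord b P i, fun j hj => ?_⟩
    rw [Pi.single_eq_of_ne]
    rintro rfl
    exact hj hi
  | one => exact ⟨0, by rw [map_one, zpow_zero], fun _ _ => rfl⟩
  | mul x y _ _ hx hy =>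
    obtain ⟨d, hd, hd'⟩ := hx
    obtain ⟨e, he, he'⟩ := hy
    exact ⟨d + e, by rw [map_mul, hd, he, zpow_add], fun i hi => by simp [hd' i hi, he' i hi]⟩

lemma isUnit_denominators (s : denominators (localCoord b P)) :
    IsUnit (algebraMap (PolyFun k V) (Module.End (PolyFun k V) (Laurent b P)) s) := by
  have h : (s : PolyFun k V) ∈ Submonoid.closure (localCoord b P '' Set.univ) := by
    rw [Set.image_univ]; exact s.2
  obtain ⟨e, he, -⟩ := expansion_of_mem_closure b P _ h
  refine (Module.End.isUnit_iff _).mpr (Function.bijective_iff_has_inverse.mpr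
    ⟨fun p => zpow b P (-e) * p, fun p => ?_, fun p => ?_⟩)
  · change zpow b P (-e) * (expansion b P s * p) = p
    rw [he, ← mul_assoc, ← zpow_add, neg_add_cancel, zpow_zero, one_mul]
  · change expansion b P s * (zpow b P (-e) * p) = p
    rw [he, ← mul_assoc, ← zpow_add, add_neg_cancel, zpow_zero, one_mul]

/-- The expansion of a meromorphic form `f dz / s`, with `s` a product of local coordinates, in
Laurent monomials `z ^ e dz`. -/
def laurentExpansion : LocalizedModule (denominators (localCoord b P)) (Forms k V n)
    →ₗ[PolyFun k V] Laurent b P :=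
  LocalizedModule.lift _ (Algebra.linearMap (PolyFun k V) (Laurent b P) ∘ₗ jacobian b)
    (isUnit_denominators b P)

lemma laurentExpansion_mk (ω : Forms k V n) (s : denominators (localCoord b P)) (e : Fin n → ℤ)
    (he : expansion b P s = zpow b P e) :
    laurentExpansion b P (LocalizedModule.mk ω s) =
      zpow b P (-e) * expansion b P (jacobian b ω) := by
  rw [laurentExpansion, LocalizedModule.lift_mk, Module.End.algebraMap_isUnit_inv_apply_eq_iff]
  change expansion b P (jacobian b ω) = expansion b P s * _
  rw [he, ← mul_assoc, ← zpow_add, add_neg_cancel, zpow_zero, one_mul]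

/-- Polynomials have no negative powers in their expansion. -/
lemma laurentCoeff_expansion_of_neg (f : PolyFun k V) (e : Fin n → ℤ) (i : Fin n) (hi : e i < 0) :
    laurentCoeff b P e (expansion b P f) = 0 := by
  have hf : f ∈ Submodule.span k
      (Submonoid.closure (Set.range (localCoord b P)) : Set (PolyFun k V)) := by
    rw [← Algebra.adjoin_eq_span, adjoin_localCoord]; trivial
  induction hf using Submodule.span_induction generalizing e with
  | mem x hx =>
    clear f
    induction hx using Submonoid.closure_induction generalizing e with
    | mem x hx =>
      obtain ⟨j, rfl⟩ := hx
      rw [expansion_localCoord, laurentCoeff_zpow, if_neg]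
      rintro rfl
      have : (0 : ℤ) ≤ (Pi.single j 1 : Fin n → ℤ) i := by
        rw [Pi.single_apply]; split_ifs <;> simp
      omega
    | one =>
      rw [map_one, ← zpow_zero, laurentCoeff_zpow, if_neg]
      rintro rfl
      simp at hi
    | mul x y hx hy ihx ihy =>
      obtain ⟨d, hd, -⟩ := expansion_of_mem_closure b P Set.univ (Set.image_univ ▸ hx)
      have hd' : 0 ≤ d i := by
        by_contra! h
        have := ihx d h
        rw [hd, laurentCoeff_zpow, if_pos rfl] at this
        exact one_ne_zero this
      rw [map_mul, hd, laurentCoeff_zpow_mul]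
      refine ihy _ ?_
      simp only [Pi.sub_apply]
      omega
  | zero => simp
  | add x y _ _ hx hy => rw [map_add, map_add, hx e hi, hy e hi, add_zero]
  | smul c x _ hx => rw [map_smul, map_smul, hx e hi, smul_zero]

/-- The coefficient of `dz / (z_1 ⋯ z_n)` in the expansion of a meromorphic form. -/
def formResidue : LocalizedModule (denominators (localCoord b P)) (Forms k V n) →+ k :=
  (laurentCoeff b P (-1)).toAddMonoidHom.comp (laurentExpansion b P).toAddMonoidHom

lemma formResidue_boundary {x} (hx : x ∈ cechBoundaries (localCoord b P) (Forms k V n)) :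
    formResidue b P x = 0 := by
  rw [cechBoundaries] at hx
  induction hx using Submodule.iSup_induction' with
  | mem i x hx =>
    suffices h : ∀ g : PolyFun k V, formResidue b P (g • x) = 0 by simpa using h 1
    induction hx using Submodule.span_induction with
    | mem y hy =>
      intro g
      obtain ⟨ω, s, hs, rfl⟩ := hy
      obtain ⟨e, he, he'⟩ := expansion_of_mem_closure b P _ hs
      rw [LocalizedModule.smul'_mk]
      change laurentCoeff b P (-1) (laurentExpansion b P _) = 0
      rw [laurentExpansion_mk b P _ s e he, laurentCoeff_zpow_mul]
      refine laurentCoeff_expansion_of_neg b P _ _ i ?_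
      have := he' i (by simp)
      simp [this]
    | zero => intro g; rw [smul_zero, map_zero]
    | add x y _ _ hx hy => intro g; rw [smul_add, map_add, hx, hy, add_zero]
    | smul f x _ hx => intro g; rw [smul_smul]; exact hx _
  | zero => exact map_zero _
  | add x y _ _ hx hy => rw [map_add, hx, hy, add_zero]

/-- The residue as an additive map. -/
def resAux : LC b P →+ k :=
  QuotientAddGroup.lift
    (cechBoundaries (localCoord b P) (Forms k V n)).toAddSubgroup (formResidue b P)
    fun _ hx => formResidue_boundary b P hx

lemma resAux_mk (x) : resAux b P (LC.mk b P x) = formResidue b P x := rfl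

lemma resAux_smul (c : k) (x : LC b P) : resAux b P (c • x) = c * resAux b P x := by
  obtain ⟨x, rfl⟩ := LC.mk_surjective b P x
  have h : c • LC.mk b P x = LC.mk b P (algebraMap k (PolyFun k V) c • x) := by
    rw [map_smul]; rfl
  rw [h, resAux_mk, resAux_mk]
  change laurentCoeff b P (-1) (laurentExpansion b P _) =
    c * laurentCoeff b P (-1) (laurentExpansion b P _)
  rw [map_smul, Algebra.smul_def, algebraMap_eq_expansion, AlgHom.commutes, ← Algebra.smul_def,
    map_smul, smul_eq_mul]

/-- The residue `Res_P : LC(V, P) ⟶ k`: the coefficient of `dz / (z_1 ⋯ z_n)` in the expansion of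
a meromorphic form. -/
def res : LC b P →ₗ[k] k where
  toFun := resAux b P
  map_add' := map_add _
  map_smul' := resAux_smul b P

/-! ### The basis of generalised fractions -/

/-- The monomial `z ^ c` in the local coordinates. -/
def mon (c : Fin n →₀ ℕ) : PolyFun k V := ∏ i, localCoord b P i ^ c i

lemma mon_zero : mon b P 0 = 1 := by simp [mon]

lemma mon_add (c d : Fin n →₀ ℕ) : mon b P (c + d) = mon b P c * mon b P d := by
  simp [mon, pow_add, Finset.prod_mul_distrib]

lemma mon_single (i : Fin n) : mon b P (Finsupp.single i 1) = localCoord b P i := by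
  classical
  rw [mon, Finset.prod_eq_single i]
  · simp
  · intro j _ hj; simp [Ne.symm hj]
  · simp

lemma expansion_mon (c : Fin n →₀ ℕ) : expansion b P (mon b P c) = zpow b P fun i => (c i : ℤ) := by
  induction c using Finsupp.induction_linear with
  | zero => rw [mon_zero, map_one, ← zpow_zero]; rfl
  | add c d hc hd =>
    rw [mon_add, map_mul, hc, hd, ← zpow_add]
    congr 1
  | single i m =>
    induction m with
    | zero => rw [Finsupp.single_zero, mon_zero, map_one, ← zpow_zero]; rfl
    | succ m ih =>
      rw [Finsupp.single_add, mon_add, map_mul, ih, mon_single, expansion_localCoord, ← zpow_add]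
      congr 1; ext j
      by_cases h : j = i
      · subst h; simp
      · simp [h, Finsupp.single_apply, Ne.symm h]

lemma mem_span_mon (f : PolyFun k V) : f ∈ Submodule.span k (Set.range (mon b P)) := by
  have hf : f ∈ Submodule.span k
      (Submonoid.closure (Set.range (localCoord b P)) : Set (PolyFun k V)) := by
    rw [← Algebra.adjoin_eq_span, adjoin_localCoord]; trivial
  refine Submodule.span_mono ?_ hf
  intro s hs
  induction hs using Submonoid.closure_induction with
  | mem x hx => obtain ⟨i, rfl⟩ := hx; exact ⟨_, mon_single b P i⟩
  | one => exact ⟨0, mon_zero b P⟩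
  | mul x y _ _ hx hy =>
    obtain ⟨c, rfl⟩ := hx
    obtain ⟨d, rfl⟩ := hy
    exact ⟨c + d, mon_add b P c d⟩

lemma formFrac_mon_smul_add (ω : Forms k V n) (c d : Fin n →₀ ℕ) :
    LC.formFrac b P (mon b P c • ω) (c + d) = LC.formFrac b P ω d := by
  refine congrArg (LC.mk b P) ?_
  rw [LocalizedModule.mk_eq]
  refine ⟨1, ?_⟩
  simp only [one_smul, Submonoid.smul_def]
  rw [smul_smul]
  congr 1
  change mon b P d * mon b P c = mon b P (c + d)
  rw [mon_add, mul_comm]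

lemma formFrac_eq_zero (ω : Forms k V n) (d : Fin n →₀ ℕ) (i : Fin n) (hi : d i = 0) :
    LC.formFrac b P ω d = 0 := by
  refine (Submodule.Quotient.mk_eq_zero _).mpr ?_
  refine Submodule.mem_iSup_of_mem i (Submodule.subset_span ⟨ω, _, ?_, rfl⟩)
  change ∏ j, localCoord b P j ^ d j ∈ Submonoid.closure (localCoord b P '' {j | j ≠ i})
  refine Submonoid.prod_mem _ fun j _ => ?_
  by_cases h : j = i
  · subst h; rw [hi, pow_zero]; exact Submonoid.one_mem _
  · exact Submonoid.pow_mem _ (Submonoid.subset_closure (Set.mem_image_of_mem _ h)) _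

lemma smul_formFrac (f : PolyFun k V) (ω : Forms k V n) (d : Fin n →₀ ℕ) :
    f • LC.formFrac b P ω d = LC.formFrac b P (f • ω) d := by
  refine ((LC.mk b P).map_smul f _).symm.trans (congrArg (LC.mk b P) ?_)
  rw [LocalizedModule.smul'_mk]

/-- The action of monomials on generalised fractions: exponents are subtracted, and the result is
zero if an exponent in the denominator would become negative. -/
lemma mon_smul_frac (c a : Fin n →₀ ℕ) :
    mon b P c • frac b P a = if c ≤ a then frac b P (a - c) else 0 := by
  have h : mon b P c • frac b P a = LC.formFrac b P (mon b P c • volForm b P)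
      (a + ones n) := smul_formFrac b P _ _ _
  rw [h]
  split_ifs with hca
  · rw [frac, ← formFrac_mon_smul_add b P _ c (a - c + _), ← add_assoc, add_tsub_cancel_of_le hca]
  · obtain ⟨i, hi⟩ : ∃ i, a i < c i := by
      by_contra! h'
      exact hca h'
    have h1 : c = Finsupp.single i (a i + 1) + (c - Finsupp.single i (a i + 1)) := by
      rw [add_tsub_cancel_of_le]
      rw [Finsupp.single_le_iff]; exact hi
    have h2 : a + ones n = Finsupp.single i (a i + 1) +
        (a + ones n - Finsupp.single i (a i + 1)) := by
      rw [add_tsub_cancel_of_le]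
      rw [Finsupp.single_le_iff]; simp
    rw [h1, mon_add, mul_smul, h2, formFrac_mon_smul_add]
    exact formFrac_eq_zero b P _ _ i (by simp)

lemma res_frac (a : Fin n →₀ ℕ) : res b P (frac b P a) = if a = 0 then 1 else 0 := by
  change laurentCoeff b P (-1) (laurentExpansion b P (LocalizedModule.mk _ _)) = _
  rw [laurentExpansion_mk b P _ _ _
    (expansion_mon b P (a + ones n)), jacobian_volForm, map_one, mul_one,
    laurentCoeff_zpow]
  congr 1
  rw [eq_iff_iff, neg_inj]
  constructor
  · intro h
    ext i
    have := congr_fun h i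
    simpa using this
  · rintro rfl
    ext i
    simp

lemma res_mon_smul_frac (c a : Fin n →₀ ℕ) :
    res b P (mon b P c • frac b P a) = if c = a then 1 else 0 := by
  rw [mon_smul_frac]
  split_ifs with h1 h2 h2
  · subst h2; rw [tsub_self, res_frac, if_pos rfl]
  · rw [res_frac, if_neg]
    intro h
    exact h2 (le_antisymm h1 (tsub_eq_zero_iff_le.mp h))
  · exact absurd h2.le h1
  · exact map_zero _

lemma linearIndependent_frac : LinearIndependent k (frac b P) := by
  rw [linearIndependent_iff']
  intro s g hg a ha
  have h := congr(res b P (mon b P a • $hg))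
  rw [Finset.smul_sum, map_sum, smul_zero, map_zero, Finset.sum_eq_single a] at h
  · rwa [smul_comm, map_smul, res_mon_smul_frac, if_pos rfl, smul_eq_mul, mul_one] at h
  · intro c _ hc
    rw [smul_comm, map_smul, res_mon_smul_frac, if_neg hc.symm, smul_zero]
  · intro h'; exact absurd ha h'

lemma span_frac : ⊤ ≤ Submodule.span k (Set.range (frac b P)) := by
  rintro x -
  obtain ⟨x, rfl⟩ := LC.mk_surjective b P x
  induction x using LocalizedModule.induction_on with
  | h ω s =>
    have hs : ∃ d, (s : PolyFun k V) = mon b P d := by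
      obtain ⟨s, hs⟩ := s
      change ∃ d, s = mon b P d
      induction hs using Submonoid.closure_induction with
      | mem x hx => obtain ⟨i, rfl⟩ := hx; exact ⟨_, (mon_single b P i).symm⟩
      | one => exact ⟨0, (mon_zero b P).symm⟩
      | mul x y _ _ hx hy =>
        obtain ⟨c, rfl⟩ := hx
        obtain ⟨d, rfl⟩ := hy
        exact ⟨c + d, (mon_add b P c d).symm⟩
    obtain ⟨d, hd⟩ := hs
    have key : ∀ f : PolyFun k V, (f • LC.formFrac b P (volForm b P) d) ∈
        Submodule.span k (Set.range (frac b P)) := by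
      intro f
      have hf := mem_span_mon b P f
      induction hf using Submodule.span_induction with
      | mem f hf =>
        obtain ⟨c, rfl⟩ := hf
        by_cases h : ∀ i, 0 < d i
        · have : LC.formFrac b P (volForm b P) d =
              frac b P (d - ones n) := by
            rw [frac, tsub_add_cancel_of_le]
            intro i
            exact h i
          rw [this, mon_smul_frac]
          split_ifs
          · exact Submodule.subset_span ⟨_, rfl⟩
          · exact Submodule.zero_mem _
        · push Not at h
          obtain ⟨i, hi⟩ := h
          have : LC.formFrac b P (volForm b P) d = 0 :=
            formFrac_eq_zero b P _ _ i (by omega)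
          rw [this, smul_zero]; exact Submodule.zero_mem _
      | zero => rw [zero_smul]; exact Submodule.zero_mem _
      | add f g _ _ hf hg => rw [add_smul]; exact Submodule.add_mem _ hf hg
      | smul c f _ hf => rw [smul_assoc]; exact Submodule.smul_mem _ _ hf
    have h := key (jacobian b ω)
    have h2 : (jacobian b ω • LC.formFrac b P (volForm b P) d) =
        LC.formFrac b P ω d := by
      refine (smul_formFrac b P _ _ _).trans ?_
      rw [jacobian_smul_volForm]
    rw [h2] at h
    obtain ⟨s, hs⟩ := s
    obtain rfl : s = mon b P d := hd
    exact h

/-- The generalised fractions `[(1 / z_1 ^ a_1, …, z_n ^ a_n) dz / z]` form a basis of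
`LC(V, P)`. -/
def fracBasis : Basis (Fin n →₀ ℕ) k (LC b P) :=
  Basis.mk (linearIndependent_frac b P) (span_frac b P)

lemma fracBasis_apply (a : Fin n →₀ ℕ) : fracBasis b P a = frac b P a := by
  rw [fracBasis, Basis.mk_apply]

lemma res_mon_smul (c : Fin n →₀ ℕ) (η : LC b P) :
    res b P (mon b P c • η) = (fracBasis b P).repr η c := by
  have : (res b P) ∘ₗ (LinearMap.lsmul (PolyFun k V) (LC b P) (mon b P c)).restrictScalars k =
      (fracBasis b P).coord c := by
    classical
    refine (fracBasis b P).ext fun a => ?_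
    have h : res b P (mon b P c • fracBasis b P a) = (fracBasis b P).coord c (fracBasis b P a) := by
      rw [Basis.coord_apply, Basis.repr_self, fracBasis_apply, res_mon_smul_frac,
        Finsupp.single_apply]
      simp only [eq_comm]
    exact h
  exact congr($this η)

/-- The residue pairing between polynomial functions and `LC(V, P)` is nondegenerate: an element
of `LC(V, P)` is determined by the functional `f ↦ Res_P (f η)`. -/
lemma LC.ext_res {η θ : LC b P} (h : ∀ f : PolyFun k V, res b P (f • η) = res b P (f • θ)) :
    η = θ := by
  refine (fracBasis b P).repr.injective (Finsupp.ext fun c => ?_)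
  rw [← res_mon_smul, ← res_mon_smul, h]

/-! ### The action of differential operators, and kets -/

/-- The action of `∂_i` on `LC(V, P)`: it sends `[(1 / z_1 ^ a_1, …, z_n ^ a_n) dz / z]` to
`(a_i + 1) [(1 / z_1 ^ a_1, …, z_i ^ (a_i + 1), …, z_n ^ a_n) dz / z]`. -/
def LC.coordDeriv (i : Fin n) : LC b P →ₗ[k] LC b P :=
  (fracBasis b P).constr k fun a => ((a i : k) + 1) • frac b P (a + Finsupp.single i 1)

/-- The action of `∂_ν = ∑ ν_i ∂_i` on `LC(V, P)`.  It is the transpose under the residue pairing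
of the action of `∂_ν` on polynomial functions, see `LC.res_smul_deriv`. -/
def LC.deriv (ν : V) : LC b P →ₗ[k] LC b P :=
  ∑ i, b.coord i ν • LC.coordDeriv b P i

lemma LC.coordDeriv_frac (i : Fin n) (a : Fin n →₀ ℕ) :
    LC.coordDeriv b P i (frac b P a) = ((a i : k) + 1) • frac b P (a + Finsupp.single i 1) := by
  rw [← fracBasis_apply, LC.coordDeriv, Basis.constr_basis]

lemma LC.smul_coordDeriv (i : Fin n) (f : PolyFun k V) (η : LC b P) :
    f • LC.coordDeriv b P i η =
      LC.coordDeriv b P i (f • η) + dirDeriv (b i) f • η := by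
  have hf : f ∈ Algebra.adjoin k (Set.range (localCoord b P)) := by
    rw [adjoin_localCoord]; trivial
  induction hf using Algebra.adjoin_induction generalizing η with
  | mem x hx =>
    obtain ⟨j, rfl⟩ := hx
    have : ((LinearMap.lsmul (PolyFun k V) (LC b P) (localCoord b P j)).restrictScalars k) ∘ₗ
          LC.coordDeriv b P i =
        LC.coordDeriv b P i ∘ₗ
          ((LinearMap.lsmul (PolyFun k V) (LC b P) (localCoord b P j)).restrictScalars k) +
        (LinearMap.lsmul (PolyFun k V) (LC b P)
          (dirDeriv (b i) (localCoord b P j))).restrictScalars k := by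
      refine (fracBasis b P).ext fun a => ?_
      change localCoord b P j • LC.coordDeriv b P i (fracBasis b P a) =
        LC.coordDeriv b P i (localCoord b P j • fracBasis b P a) +
          dirDeriv (b i) (localCoord b P j) • fracBasis b P a
      rw [fracBasis_apply, LC.coordDeriv_frac, smul_comm, ← mon_single, mon_smul_frac,
        mon_smul_frac, mon_single, dirDeriv_localCoord]
      by_cases hij : j = i
      · subst hij
        rw [if_pos le_add_self, add_tsub_cancel_right, if_pos rfl, one_smul]
        split_ifs with h
        · rw [LC.coordDeriv_frac, tsub_add_cancel_of_le h]
          rw [Finsupp.single_le_iff] at h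
          obtain ⟨c, hc⟩ := Nat.exists_eq_add_of_le' h
          simp [hc, add_smul]
        · rw [Finsupp.single_le_iff] at h
          have : a j = 0 := by omega
          simp [this]
      · rw [if_neg hij, zero_smul, add_zero]
        have hle : Finsupp.single j 1 ≤ a + Finsupp.single i 1 ↔ Finsupp.single j 1 ≤ a := by
          rw [Finsupp.single_le_iff, Finsupp.single_le_iff]
          simp [Ne.symm hij]
        simp only [hle]
        split_ifs with h
        · rw [LC.coordDeriv_frac, tsub_add_eq_add_tsub h]
          simp [hij]
        · simp
    exact congr($this η)
  | algebraMap r => simp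
  | add x y _ _ hx hy => simp only [add_smul, map_add, hx, hy]; abel
  | mul x y _ _ hx hy =>
    rw [mul_smul, hy, smul_add, hx, Derivation.leibniz, mul_smul, add_smul, smul_smul, smul_assoc,
      smul_smul, smul_eq_mul]
    simp only [smul_smul, mul_comm]
    abel

lemma LC.res_coordDeriv (i : Fin n) (η : LC b P) : res b P (LC.coordDeriv b P i η) = 0 := by
  have : res b P ∘ₗ LC.coordDeriv b P i = 0 := by
    refine (fracBasis b P).ext fun a => ?_
    rw [LinearMap.comp_apply, fracBasis_apply, LC.coordDeriv_frac, map_smul, res_frac, if_neg]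
    · simp
    · intro h
      have := congr($h i)
      simp at this
  exact congr($this η)

/-- The operator `∂_ν` on `LC(V, P)` is the transpose, with respect to the residue pairing, of the
derivative `∂_ν` of polynomial functions. -/
lemma LC.res_smul_deriv (ν : V) (f : PolyFun k V) (η : LC b P) :
    res b P (f • LC.deriv b P ν η) = res b P (dirDeriv ν f • η) := by
  have h : dirDeriv ν f = ∑ i, b.coord i ν • dirDeriv (b i) f := by
    induction f using SymmetricAlgebra.induction with
    | algebraMap r => simp
    | ι l =>
      have h1 := fun μ => dirDeriv_linForm μ l
      simp only [linForm] at h1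
      simp only [h1]
      conv_lhs => rw [← b.sum_repr ν, map_sum, map_sum]
      simp [Algebra.smul_def]
    | mul x y hx hy =>
      simp only [Derivation.leibniz, hx, hy, smul_add, Finset.sum_add_distrib, Finset.smul_sum,
        smul_comm x, smul_comm y]
    | add x y hx hy => simp only [map_add, hx, hy, smul_add, Finset.sum_add_distrib]
  simp only [h, LC.deriv, LinearMap.sum_apply, LinearMap.smul_apply, Finset.smul_sum,
    Finset.sum_smul, map_sum]
  refine Finset.sum_congr rfl fun i _ => ?_
  rw [smul_comm f, (res b P).map_smul, LC.smul_coordDeriv, map_add, LC.res_coordDeriv, zero_add,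
    smul_assoc (b.coord i ν), (res b P).map_smul]

/-- The vacuum `|0⟩_P`, that is the generalised fraction `[dz / z]`. -/
def LC.vacuum : LC b P := frac b P 0

/-- The state `|ν_1, …, ν_s⟩_P = ∂_{ν_1} ⋯ ∂_{ν_s} |0⟩_P` of `LC(V, P)`. -/
def LC.ket {s : ℕ} (ν : Fin s → V) : LC b P :=
  (List.ofFn ν).foldr (fun v η => LC.deriv b P v η) (LC.vacuum b P)

/-! ### The coalgebra structure -/

/-- The coproduct of `LC(V, P)`, given on generalised fractions by
`[1 / z ^ a] ↦ ∑_{c + d = a} [1 / z ^ c] ⊗ [1 / z ^ d]`.  It is the transpose under the residue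
pairing of the multiplication of polynomial functions, see `LC.res_mul_smul`. -/
def LC.comul : LC b P →ₗ[k] LC b P ⊗[k] LC b P :=
  (fracBasis b P).constr k fun a =>
    ∑ p ∈ Finset.HasAntidiagonal.antidiagonal a, frac b P p.1 ⊗ₜ[k] frac b P p.2

lemma LC.comul_frac (a : Fin n →₀ ℕ) : LC.comul b P (frac b P a) =
    ∑ p ∈ Finset.HasAntidiagonal.antidiagonal a, frac b P p.1 ⊗ₜ[k] frac b P p.2 := by
  rw [← fracBasis_apply, LC.comul, Basis.constr_basis]

instance : Coalgebra k (LC b P) where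
  comul := LC.comul b P
  counit := res b P
  coassoc := by
    refine (fracBasis b P).ext fun a => ?_
    simp only [LinearMap.comp_apply, fracBasis_apply, LC.comul_frac, map_sum,
      LinearMap.rTensor_tmul, LinearMap.lTensor_tmul, TensorProduct.sum_tmul,
      TensorProduct.tmul_sum, LinearEquiv.coe_coe, TensorProduct.assoc_tmul]
    rw [Finset.sum_sigma', Finset.sum_sigma']
    refine Finset.sum_nbij' (fun x => ⟨(x.2.1, x.2.2 + x.1.2), (x.2.2, x.1.2)⟩)
      (fun x => ⟨(x.1.1 + x.2.1, x.2.2), (x.1.1, x.2.1)⟩) ?_ ?_ ?_ ?_ ?_ <;>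
    · rintro ⟨⟨p, q⟩, ⟨c, d⟩⟩ h
      simp only [Finset.mem_sigma, Finset.HasAntidiagonal.mem_antidiagonal] at h
      obtain ⟨rfl, rfl⟩ := h
      simp [add_assoc]
  rTensor_counit_comp_comul := by
    refine (fracBasis b P).ext fun a => ?_
    simp only [LinearMap.comp_apply, fracBasis_apply, LC.comul_frac, map_sum,
      LinearMap.rTensor_tmul, res_frac, TensorProduct.mk_apply]
    rw [Finset.sum_eq_single (0, a)]
    · simp
    · rintro ⟨c, d⟩ h hne
      rw [Finset.HasAntidiagonal.mem_antidiagonal] at h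
      rw [if_neg, TensorProduct.zero_tmul]
      rintro rfl
      simp at h hne
      exact hne h
    · simp
  lTensor_counit_comp_comul := by
    refine (fracBasis b P).ext fun a => ?_
    simp only [LinearMap.comp_apply, fracBasis_apply, LC.comul_frac, map_sum,
      LinearMap.lTensor_tmul, res_frac, LinearMap.flip_apply, TensorProduct.mk_apply]
    rw [Finset.sum_eq_single (a, 0)]
    · simp
    · rintro ⟨c, d⟩ h hne
      rw [Finset.HasAntidiagonal.mem_antidiagonal] at h
      rw [if_neg, TensorProduct.tmul_zero]
      rintro rfl
      simp at h hne
      exact hne h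
    · simp

instance : Coalgebra.IsCocomm k (LC b P) where
  comm_comp_comul := by
    refine (fracBasis b P).ext fun a => ?_
    change TensorProduct.comm k _ _ (LC.comul b P (fracBasis b P a)) =
      LC.comul b P (fracBasis b P a)
    rw [fracBasis_apply, LC.comul_frac, map_sum]
    simp only [TensorProduct.comm_tmul]
    refine Finset.sum_nbij' Prod.swap Prod.swap ?_ ?_ ?_ ?_ ?_ <;> simp [add_comm]

/-- The functional `η ↦ Res_P (f η)` on `LC(V, P)`. -/
def LC.resMul (f : PolyFun k V) : LC b P →ₗ[k] k :=
  res b P ∘ₗ (LinearMap.lsmul (PolyFun k V) (LC b P) f).restrictScalars k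

/-- The coproduct of `LC(V, P)` is the transpose, with respect to the residue pairing, of the
multiplication of polynomial functions. -/
lemma LC.res_mul_smul (f g : PolyFun k V) (η : LC b P) :
    LinearMap.mul' k k (TensorProduct.map (LC.resMul b P f) (LC.resMul b P g)
      (Coalgebra.comul (R := k) η)) = res b P ((f * g) • η) := by
  classical
  have hmon : ∀ c a, LC.resMul b P (mon b P c) (frac b P a) = if c = a then 1 else 0 :=
    res_mon_smul_frac b P
  have hadd : ∀ f₁ f₂, LC.resMul b P (f₁ + f₂) = LC.resMul b P f₁ + LC.resMul b P f₂ := by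
    intro f₁ f₂; ext x; simp [LC.resMul]
  have hsmul : ∀ (r : k) f₁, LC.resMul b P (r • f₁) = r • LC.resMul b P f₁ := by
    intro r f₁; ext x; simp [LC.resMul]
  have hzero : LC.resMul b P 0 = 0 := by ext x; simp [LC.resMul]
  have key : LinearMap.mul' k k ∘ₗ TensorProduct.map (LC.resMul b P f) (LC.resMul b P g) ∘ₗ
      LC.comul b P = LC.resMul b P (f * g) := by
    have hf := mem_span_mon b P f
    have hg := mem_span_mon b P g
    induction hf using Submodule.span_induction with
    | zero => simp [hzero]
    | add x y _ _ hx hy =>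
      rw [hadd, add_mul, hadd, TensorProduct.map_add_left, LinearMap.add_comp, LinearMap.comp_add,
        hx, hy]
    | smul r x _ hx =>
      rw [hsmul, smul_mul_assoc, hsmul, TensorProduct.map_smul_left, LinearMap.smul_comp,
        LinearMap.comp_smul, hx]
    | mem x hx =>
      obtain ⟨c, rfl⟩ := hx
      induction hg using Submodule.span_induction with
      | zero => simp [hzero]
      | add x y _ _ hx hy =>
        rw [hadd, mul_add, hadd, TensorProduct.map_add_right, LinearMap.add_comp,
          LinearMap.comp_add, hx, hy]
      | smul r x _ hx =>
        rw [hsmul, mul_smul_comm, hsmul, TensorProduct.map_smul_right, LinearMap.smul_comp,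
          LinearMap.comp_smul, hx]
      | mem x hx =>
        obtain ⟨d, rfl⟩ := hx
        refine (fracBasis b P).ext fun a => ?_
        simp only [LinearMap.comp_apply, fracBasis_apply, LC.comul_frac, map_sum,
          TensorProduct.map_tmul, LinearMap.mul'_apply, ← mon_add, hmon]
        split_ifs with h
        · rw [Finset.sum_eq_single (c, d)]
          · simp
          · rintro ⟨c', d'⟩ _ hne
            by_cases h1 : c = c'
            · rw [if_neg (show ¬ d = d' by rintro rfl; exact hne (by rw [h1])), mul_zero]
            · rw [if_neg h1, zero_mul]
          · intro h'; exact absurd (Finset.HasAntidiagonal.mem_antidiagonal.mpr h) h'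
        · refine Finset.sum_eq_zero ?_
          rintro ⟨c', d'⟩ h'
          rw [Finset.HasAntidiagonal.mem_antidiagonal] at h'
          by_cases h1 : c = c'
          · rw [if_neg (show ¬ d = d' by rintro rfl; exact h (by rw [h1]; exact h')), mul_zero]
          · rw [if_neg h1, zero_mul]
  exact congr($key η)

/-! ### The coalgebra `!V` and its universal map -/

/-- The coalgebra `!V = ⨁_{P ∈ V} LC(V, P)`. -/
def Bang : Type (max u v) := Π₀ P : V, LC b P

instance : AddCommGroup (Bang b) := inferInstanceAs (AddCommGroup (Π₀ P : V, LC b P))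

instance : Module k (Bang b) := inferInstanceAs (Module k (Π₀ P : V, LC b P))

/-- The direct sum of the coalgebra structures of the summands. -/
instance : Coalgebra k (Bang b) :=
  letI := Classical.decEq V
  inferInstanceAs (Coalgebra k (Π₀ P : V, LC b P))

instance : Coalgebra.IsCocomm k (Bang b) :=
  letI := Classical.decEq V
  inferInstanceAs (Coalgebra.IsCocomm k (Π₀ P : V, LC b P))

/-- The inclusion of the summand of `P` into `!V`. -/
def Bang.incl : LC b P →ₗ[k] Bang b :=
  letI := Classical.decEq V
  (DFinsupp.lsingle P : LC b P →ₗ[k] Π₀ Q : V, LC b Q)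

/-- The map `d_P : LC(V, P) ⟶ V`, `η ↦ ∑ i, Res_P (x_i η) e_i`. -/
def LC.dereliction : LC b P →ₗ[k] V :=
  ∑ i, (LC.resMul b P (linForm V (b.coord i))).smulRight (b i)

/-- The dereliction map `d = ∑_P d_P : !V ⟶ V`. -/
def Bang.dereliction : Bang b →ₗ[k] V :=
  letI := Classical.decEq V
  DFinsupp.lsum k fun P => LC.dereliction b P

/-- The element `|ν_1, …, ν_s⟩_P` of `!V`. -/
def Bang.ket {s : ℕ} (ν : Fin s → V) : Bang b :=
  Bang.incl b P (LC.ket b P ν)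

end Sweedler

end

noncomputable section

namespace Sweedler

variable {k : Type*} [Field k] {V : Type*} [AddCommGroup V] [Module k V] {n : ℕ}
variable (b : Basis (Fin n) k V) (P : V)

/-! ### The maximal ideal of a point and its action on local cohomology -/

/-! The residue pairing turns statements about `!V` into statements about polynomial functions. An
element `x` of `!V` gives the functional `f ↦ ∑ P, Res_P (f x_P)` on `Sym(V*)`. This functional
determines `x` (`Bang.eq_zero_of_resMul`): functions vanishing at `P` act locally nilpotently on
`LC(V, P)` and the others act injectively, so a suitable function kills all components of `x` but a
chosen one.

Uniqueness. In terms of these functionals, the counit is the value on `1`, the dereliction gives the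
values on linear forms, and the coproduct is the transpose of multiplication. Since linear forms
generate `Sym(V*)`, a coalgebra morphism `Φ` over `ψ` must be the transpose of `f ↦ f ∘ ψ`
(`Bang.resMul_coalgHom`), and the pairing leaves only one such map.

Existence. Composition with `ψ` carries functions vanishing at `ψ(P)` to functions vanishing at `P`.
Hence, for `η` in `LC(W, P)`, the functional `f ↦ Res_P ((f ∘ ψ) η)` is nonzero on only finitely
many monomials in the coordinates at `ψ(P)`, and so comes from an element of `LC(V, ψ(P))`. This
defines `LC.map`. It respects the coproducts and counits because composition with `ψ` is a morphism
of algebras (`LC.comul_map`, `LC.res_map`).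

Kets. `|0⟩_P` represents evaluation at `P` and `∂_ν` is the transpose of the directional derivative,
so the formula on kets is the transpose of the chain rule `dirDeriv_pullback`. -/

lemma evalAt_linForm (l : Dual k V) : evalAt P (linForm V l) = l P := by
  rw [evalAt, linForm, SymmetricAlgebra.lift_ι_apply]; rfl

lemma evalAt_localCoord (i : Fin n) : evalAt P (localCoord b P i) = 0 := by
  rw [localCoord, map_sub, evalAt_linForm, AlgHom.commutes]
  exact sub_self _

/-- The functions with this property form a subalgebra containing the local coordinates, which
generate. In consequence the kernel of evaluation at `P` is the ideal of the `z_i`. -/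
lemma sub_evalAt_mem_span_localCoord (f : PolyFun k V) :
    f - algebraMap k _ (evalAt P f) ∈ Ideal.span (Set.range (localCoord b P)) := by
  have hf : f ∈ Algebra.adjoin k (Set.range (localCoord b P)) := by
    rw [adjoin_localCoord]; trivial
  induction hf using Algebra.adjoin_induction with
  | mem x hx =>
    obtain ⟨i, rfl⟩ := hx
    rw [evalAt_localCoord, map_zero, sub_zero]
    exact Ideal.subset_span ⟨i, rfl⟩
  | algebraMap r => simp
  | add x y _ _ hx hy =>
    rw [map_add, map_add, add_sub_add_comm]
    exact Ideal.add_mem _ hx hy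
  | mul x y _ _ hx hy =>
    rw [map_mul, map_mul, show x * y - algebraMap k (PolyFun k V) (evalAt P x) *
        algebraMap k _ (evalAt P y) = x * (y - algebraMap k _ (evalAt P y)) +
        algebraMap k _ (evalAt P y) * (x - algebraMap k _ (evalAt P x)) by ring]
    exact Ideal.add_mem _ (Ideal.mul_mem_left _ _ hy) (Ideal.mul_mem_left _ _ hx)

/-- The local coordinates at `P` act locally nilpotently on `LC(V, P)`. -/
lemma LC.exists_localCoord_pow_smul_eq_zero (i : Fin n) (η : LC b P) :
    ∃ N : ℕ, localCoord b P i ^ N • η = 0 := by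
  have hη := span_frac b P (Submodule.mem_top (x := η))
  induction hη using Submodule.span_induction with
  | mem x hx =>
    obtain ⟨a, rfl⟩ := hx
    refine ⟨a i + 1, ?_⟩
    have : localCoord b P i ^ (a i + 1) = mon b P (Finsupp.single i (a i + 1)) := by
      rw [mon, Finset.prod_eq_single i]
      · simp
      · intro j _ hj; simp [Ne.symm hj]
      · simp
    rw [this, mon_smul_frac, if_neg]
    rw [Finsupp.single_le_iff]
    omega
  | zero => exact ⟨0, smul_zero _⟩
  | add x y _ _ hx hy =>
    obtain ⟨N, hN⟩ := hx
    obtain ⟨M, hM⟩ := hy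
    refine ⟨N + M, ?_⟩
    rw [smul_add, pow_add, mul_smul, mul_smul, hM, smul_zero, add_zero, smul_comm, hN, smul_zero]
  | smul c x _ hx =>
    obtain ⟨N, hN⟩ := hx
    exact ⟨N, by rw [smul_comm, hN, smul_zero]⟩

/-- The functions vanishing at `P` act locally nilpotently on `LC(V, P)`. -/
lemma LC.exists_pow_smul_eq_zero {f : PolyFun k V} (hf : evalAt P f = 0) (η : LC b P) :
    ∃ N : ℕ, f ^ N • η = 0 := by
  -- The radical of the annihilator of `η` is an ideal, so it is enough that it contains each `z_i`.
  have h : Ideal.span (Set.range (localCoord b P)) ≤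
      Ideal.radical (LinearMap.ker (LinearMap.toSpanSingleton (PolyFun k V) (LC b P) η)) := by
    rw [Ideal.span_le]
    rintro _ ⟨i, rfl⟩
    obtain ⟨N, hN⟩ := LC.exists_localCoord_pow_smul_eq_zero b P i η
    exact ⟨N, by simpa using hN⟩
  have hm := sub_evalAt_mem_span_localCoord b P f
  rw [hf, map_zero, sub_zero] at hm
  obtain ⟨N, hN⟩ := h hm
  exact ⟨N, by simpa using hN⟩

/-- A function that does not vanish at `P` acts injectively on `LC(V, P)`. -/
lemma LC.eq_zero_of_smul_eq_zero {f : PolyFun k V} (hf : evalAt P f ≠ 0) {η : LC b P}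
    (h : f • η = 0) : η = 0 := by
  obtain ⟨N, hN⟩ := LC.exists_pow_smul_eq_zero b P
    (f := f - algebraMap k _ (evalAt P f)) (by simp) η
  -- On a vector killed by `f`, the nilpotent operator `f - f(P)` is multiplication by the nonzero
  -- scalar `-f(P)`.
  have h1 : ∀ M : ℕ, (f - algebraMap k (PolyFun k V) (evalAt P f)) ^ M • η =
      (-evalAt P f) ^ M • η := by
    intro M
    induction M with
    | zero => simp
    | succ M ih =>
      rw [pow_succ, mul_smul, sub_smul, h, zero_sub, algebraMap_smul, ← neg_smul, smul_comm, ih,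
        smul_smul, ← pow_succ']
  rw [h1] at hN
  exact (smul_eq_zero.mp hN).resolve_left (pow_ne_zero _ (neg_ne_zero.mpr hf))

lemma LC.resMul_apply (f : PolyFun k V) (η : LC b P) : LC.resMul b P f η = res b P (f • η) := rfl

lemma LC.resMul_algebraMap (c : k) (η : LC b P) :
    LC.resMul b P (algebraMap k _ c) η = c * res b P η := by
  rw [LC.resMul_apply, algebraMap_smul, map_smul, smul_eq_mul]

/-- Holds by expanding `l` in the coordinate functions; it characterises the dereliction without
reference to a basis. -/
lemma LC.coord_dereliction (l : Dual k V) (η : LC b P) :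
    l (LC.dereliction b P η) = LC.resMul b P (linForm V l) η := by
  have hl : linForm V l = ∑ i, l (b i) • linForm V (b.coord i) := by
    have : l = ∑ i, l (b i) • b.coord i := b.ext fun j => by simp
    simp only [linForm]
    conv_lhs => rw [this, map_sum]
    simp only [map_smul]
  rw [hl, LC.resMul_apply, Finset.sum_smul, map_sum]
  simp only [LC.dereliction, LinearMap.sum_apply, LinearMap.smulRight_apply, map_sum, map_smul,
    smul_eq_mul, smul_assoc]
  exact Finset.sum_congr rfl fun i _ => mul_comm _ _

/-- Every `z_i` kills the vacuum, hence so does every function vanishing at `P`, and `f` acts on it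
as the scalar `f(P)`. -/
lemma LC.res_smul_vacuum (f : PolyFun k V) : res b P (f • LC.vacuum b P) = evalAt P f := by
  have h : ∀ g ∈ Ideal.span (Set.range (localCoord b P)), g • LC.vacuum b P = 0 := by
    intro g hg
    have : Ideal.span (Set.range (localCoord b P)) ≤
        LinearMap.ker (LinearMap.toSpanSingleton (PolyFun k V) (LC b P) (LC.vacuum b P)) := by
      rw [Ideal.span_le]
      rintro _ ⟨i, rfl⟩
      simp only [SetLike.mem_coe, LinearMap.mem_ker, LinearMap.toSpanSingleton_apply]
      rw [← mon_single, LC.vacuum, mon_smul_frac, if_neg]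
      simp
    simpa using this hg
  have h1 := h _ (sub_evalAt_mem_span_localCoord b P f)
  rw [sub_smul, sub_eq_zero] at h1
  rw [h1, algebraMap_smul, map_smul, LC.vacuum, res_frac, if_pos rfl, smul_eq_mul, mul_one]

/-! ### The residue pairing on `!V` -/

@[elab_as_elim]
lemma Bang.induction_on {p : Bang b → Prop} (x : Bang b) (zero : p 0)
    (add : ∀ x y, p x → p y → p (x + y)) (incl : ∀ P η, p (Bang.incl b P η)) : p x := by
  classical
  let := Classical.decEq V
  refine DFinsupp.induction (p := p) x zero fun P η f _ _ hf => add _ _ ?_ hf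
  exact incl P η

lemma Bang.hom_ext {M : Type*} [AddCommMonoid M] [Module k M] {f g : Bang b →ₗ[k] M}
    (h : ∀ P, f ∘ₗ Bang.incl b P = g ∘ₗ Bang.incl b P) : f = g := by
  ext x
  induction x using Bang.induction_on b with
  | zero => rw [map_zero, map_zero]
  | add x y hx hy => rw [map_add, map_add, hx, hy]
  | incl P η => exact congr($(h P) η)

/-- The linear map out of `!V` with given restrictions to the summands. -/
def Bang.lift {M : Type*} [AddCommMonoid M] [Module k M] (f : ∀ P, LC b P →ₗ[k] M) :
    Bang b →ₗ[k] M :=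
  letI := Classical.decEq V
  DFinsupp.lsum k f

lemma Bang.lift_incl {M : Type*} [AddCommMonoid M] [Module k M] (f : ∀ P, LC b P →ₗ[k] M)
    (η : LC b P) : Bang.lift b f (Bang.incl b P η) = f P η := by
  let := Classical.decEq V
  exact DFinsupp.lsum_single k f P η

lemma Bang.lift_comp_incl {M : Type*} [AddCommMonoid M] [Module k M]
    (f : ∀ P, LC b P →ₗ[k] M) : Bang.lift b f ∘ₗ Bang.incl b P = f P :=
  LinearMap.ext (Bang.lift_incl b P f)

lemma Bang.dereliction_incl (η : LC b P) :
    Bang.dereliction b (Bang.incl b P η) = LC.dereliction b P η :=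
  Bang.lift_incl b P _ η

lemma Bang.comul_incl (η : LC b P) : Coalgebra.comul (R := k) (Bang.incl b P η) =
    TensorProduct.map (Bang.incl b P) (Bang.incl b P) (Coalgebra.comul (R := k) η) := by
  let := Classical.decEq V
  exact DFinsupp.comul_single k V (fun P => LC b P) P η

lemma Bang.counit_incl (η : LC b P) :
    Coalgebra.counit (R := k) (Bang.incl b P η) = res b P η := by
  let := Classical.decEq V
  exact DFinsupp.counit_single k V (fun P => LC b P) P η

/-- The functional `x ↦ ∑ P, Res_P (f x_P)` on `!V`. -/
def Bang.resMul (f : PolyFun k V) : Bang b →ₗ[k] k :=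
  Bang.lift b fun P => LC.resMul b P f

lemma Bang.resMul_incl (f : PolyFun k V) (η : LC b P) :
    Bang.resMul b f (Bang.incl b P η) = LC.resMul b P f η :=
  Bang.lift_incl b P _ η

lemma Bang.resMul_add (f g : PolyFun k V) :
    Bang.resMul b (f + g) = Bang.resMul b f + Bang.resMul b g := by
  refine Bang.hom_ext b fun P => LinearMap.ext fun η => ?_
  simp [Bang.resMul_incl, LC.resMul_apply, add_smul]

lemma Bang.resMul_algebraMap (c : k) (x : Bang b) :
    Bang.resMul b (algebraMap k _ c) x = c * Coalgebra.counit (R := k) x := by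
  induction x using Bang.induction_on b with
  | zero => simp
  | add x y hx hy => rw [map_add, map_add, hx, hy, mul_add]
  | incl P η => rw [Bang.resMul_incl, Bang.counit_incl, LC.resMul_algebraMap]

lemma Bang.resMul_linForm (l : Dual k V) (x : Bang b) :
    Bang.resMul b (linForm V l) x = l (Bang.dereliction b x) := by
  induction x using Bang.induction_on b with
  | zero => simp
  | add x y hx hy => rw [map_add, map_add, hx, hy, map_add]
  | incl P η => rw [Bang.resMul_incl, Bang.dereliction_incl, LC.coord_dereliction]

/-- The coproduct of `!V` is the transpose of the multiplication of polynomial functions. -/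
lemma Bang.resMul_mul (f g : PolyFun k V) (x : Bang b) : Bang.resMul b (f * g) x =
    LinearMap.mul' k k (TensorProduct.map (Bang.resMul b f) (Bang.resMul b g)
      (Coalgebra.comul (R := k) x)) := by
  induction x using Bang.induction_on b with
  | zero => simp
  | add x y hx hy => simp only [map_add, hx, hy]
  | incl P η =>
    rw [Bang.resMul_incl, Bang.comul_incl, LC.resMul_apply, ← LC.res_mul_smul]
    rw [← LinearMap.comp_apply (TensorProduct.map (Bang.resMul b f) _), ← TensorProduct.map_comp]
    simp only [Bang.resMul, Bang.lift_comp_incl]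

/-! ### Separation of the elements of `!V` by polynomial functions -/

/-- The component at `P` of an element of `!V`. -/
def Bang.proj : Bang b →ₗ[k] LC b P :=
  DFinsupp.lapply P

lemma Bang.eq_zero_of_proj {x : Bang b} (h : ∀ P, Bang.proj b P x = 0) : x = 0 :=
  DFinsupp.ext h

/-- Allowing every `T` containing `S` makes sums of elements easy to treat, and lets a point outside
the support be added later. -/
lemma Bang.exists_finset_resMul (x : Bang b) : ∃ S : Finset V, ∀ T : Finset V, S ⊆ T → ∀ f,
    Bang.resMul b f x = ∑ P ∈ T, LC.resMul b P f (Bang.proj b P x) := by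
  classical
  induction x using Bang.induction_on b with
  | zero => exact ⟨∅, fun T _ f => by simp⟩
  | add x y hx hy =>
    obtain ⟨S, hS⟩ := hx
    obtain ⟨T, hT⟩ := hy
    refine ⟨S ∪ T, fun U hU f => ?_⟩
    simp only [map_add, Finset.sum_add_distrib]
    rw [hS U (Finset.union_subset_left hU), hT U (Finset.union_subset_right hU)]
  | incl P η =>
    refine ⟨{P}, fun T hT f => ?_⟩
    rw [Finset.sum_eq_single P, Bang.resMul_incl]
    · congr 1
      exact (DFinsupp.single_eq_same (i := P)).symm
    · intro Q _ hQ
      have : Bang.proj b Q (Bang.incl b P η) = 0 := DFinsupp.single_eq_of_ne hQ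
      rw [this, map_zero]
    · intro h; exact absurd (hT (Finset.mem_singleton_self P)) h

/-- The residue pairing separates the points of `!V`. -/
lemma Bang.eq_zero_of_resMul {x : Bang b} (h : ∀ f, Bang.resMul b f x = 0) : x = 0 := by
  classical
  refine Bang.eq_zero_of_proj b fun Q => ?_
  obtain ⟨S, hS⟩ := Bang.exists_finset_resMul b x
  -- Some coordinate distinguishes `P` from `Q`; a high power of `z_i = x_i - P_i` kills the
  -- component at `P` without vanishing at `Q`.
  have hsep : ∀ P, P ≠ Q → ∃ g : PolyFun k V, g • Bang.proj b P x = 0 ∧ evalAt Q g ≠ 0 := by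
    intro P hPQ
    obtain ⟨i, hi⟩ : ∃ i, b.coord i P ≠ b.coord i Q := by
      by_contra! h'
      exact hPQ (b.ext_elem h')
    obtain ⟨N, hN⟩ := LC.exists_localCoord_pow_smul_eq_zero b P i (Bang.proj b P x)
    refine ⟨_, hN, ?_⟩
    rw [map_pow, localCoord, map_sub, evalAt_linForm, AlgHom.commutes]
    exact pow_ne_zero _ (sub_ne_zero.mpr hi.symm)
  choose! g hg hgQ using hsep
  have hQ : evalAt Q (∏ P ∈ S.erase Q, g P) ≠ 0 := by
    rw [map_prod]
    exact Finset.prod_ne_zero_iff.mpr fun P hP => hgQ P (Finset.ne_of_mem_erase hP)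
  -- The product of the `g P` acts injectively at `Q`, so it may be applied first. Pairing `x` with
  -- `f` times this product leaves only the term at `Q`; the sum is taken over `insert Q S` because
  -- `Q` need not lie in `S`.
  refine LC.eq_zero_of_smul_eq_zero b Q hQ (LC.ext_res b Q fun f => ?_)
  rw [smul_zero, map_zero, smul_smul, ← h (f * ∏ P ∈ S.erase Q, g P),
    hS _ (Finset.subset_insert Q S), Finset.sum_eq_single Q]
  · rfl
  · intro P hP hPQ
    have hP' : P ∈ S.erase Q := Finset.mem_erase.mpr ⟨hPQ, Finset.mem_of_mem_insert_of_ne hP hPQ⟩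
    rw [LC.resMul_apply, ← Finset.prod_erase_mul _ _ hP', mul_smul, mul_smul, hg P hPQ, smul_zero,
      smul_zero, map_zero]
  · intro h'; exact absurd (Finset.mem_insert_self Q S) h'

lemma Bang.ext_resMul {x y : Bang b} (h : ∀ f, Bang.resMul b f x = Bang.resMul b f y) :
    x = y :=
  sub_eq_zero.mp (Bang.eq_zero_of_resMul b fun f => by rw [map_sub, h f, sub_self])

end Sweedler

end

noncomputable section

namespace Sweedler

variable {k : Type*} [Field k] {V W : Type*} [AddCommGroup V] [Module k V]
  [AddCommGroup W] [Module k W] {m n : ℕ}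

/-! ### Functoriality -/

/-- Composition of polynomial functions with a linear map. -/
def pullback (ψ : W →ₗ[k] V) : PolyFun k V →ₐ[k] PolyFun k W :=
  SymmetricAlgebra.lift (SymmetricAlgebra.ι k (Dual k W) ∘ₗ ψ.dualMap)

lemma pullback_linForm (ψ : W →ₗ[k] V) (l : Dual k V) :
    pullback ψ (linForm V l) = linForm W (l ∘ₗ ψ) := by
  rw [pullback, linForm, SymmetricAlgebra.lift_ι_apply]; rfl

lemma evalAt_pullback (ψ : W →ₗ[k] V) (P : W) (f : PolyFun k V) :
    evalAt P (pullback ψ f) = evalAt (ψ P) f := by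
  have : (evalAt P).comp (pullback ψ) = evalAt (ψ P) := by
    refine SymmetricAlgebra.algHom_ext (LinearMap.ext fun l => ?_)
    change evalAt P (pullback ψ (linForm V l)) = evalAt (ψ P) (linForm V l)
    rw [pullback_linForm, evalAt_linForm, evalAt_linForm, LinearMap.comp_apply]
  exact congr($this f)

/-- The chain rule: both sides obey the same Leibniz rule in `f`, and on a linear form `l` both are
the constant `l(ψ(ν))`. -/
lemma dirDeriv_pullback (ψ : W →ₗ[k] V) (ν : W) (f : PolyFun k V) :
    dirDeriv ν (pullback ψ f) = pullback ψ (dirDeriv (ψ ν) f) := by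
  induction f using SymmetricAlgebra.induction with
  | algebraMap r => simp
  | ι l =>
    change dirDeriv ν (pullback ψ (linForm V l)) = pullback ψ (dirDeriv (ψ ν) (linForm V l))
    rw [pullback_linForm, dirDeriv_linForm, dirDeriv_linForm, AlgHom.commutes,
      LinearMap.comp_apply]
  | mul x y hx hy => simp only [map_mul, Derivation.leibniz, map_add, smul_eq_mul, hx, hy]
  | add x y hx hy => simp only [map_add, hx, hy]

variable (bW : Basis (Fin m) k W) (bV : Basis (Fin n) k V) (ψ : W →ₗ[k] V) (P : W)

/-- The pulled back coordinates vanish at `P`, so a power of each kills `η`. These residues are to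
be the coefficients of the image of `η` in the basis of generalised fractions. -/
lemma LC.finite_res_pullback_mon (η : LC bW P) :
    (Function.support fun a => res bW P (pullback ψ (mon bV (ψ P) a) • η)).Finite := by
  have hN : ∀ i, ∃ N : ℕ, pullback ψ (localCoord bV (ψ P) i) ^ N • η = 0 := fun i =>
    LC.exists_pow_smul_eq_zero bW P (by rw [evalAt_pullback, evalAt_localCoord]) η
  choose N hN using hN
  -- Only exponents in the box `a ≤ N` can contribute: if `N i < a i`, the factor `z_i ^ N i` splits
  -- off and its pullback kills `η`.
  refine (Set.finite_Iic (Finsupp.equivFunOnFinite.symm N)).subset fun a ha i => ?_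
  by_contra! hi
  refine ha ?_
  obtain ⟨c, hc⟩ := Nat.exists_eq_add_of_le' hi.le
  have : mon bV (ψ P) a = (∏ j ∈ Finset.univ.erase i, localCoord bV (ψ P) j ^ a j) *
      localCoord bV (ψ P) i ^ c * localCoord bV (ψ P) i ^ N i := by
    rw [mon, ← Finset.prod_erase_mul _ _ (Finset.mem_univ i), hc, mul_assoc, ← pow_add]
    rfl
  change res bW P (pullback ψ (mon bV (ψ P) a) • η) = 0
  rw [this, map_mul, mul_smul, map_pow, hN, smul_zero, map_zero]

/-- The map `LC(W, P) ⟶ LC(V, ψ(P))` that is the transpose under the residue pairings of the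
composition of polynomial functions with `ψ`. -/
def LC.map : LC bW P →ₗ[k] LC bV (ψ P) where
  toFun η := (fracBasis bV (ψ P)).repr.symm
    (Finsupp.ofSupportFinite _ (LC.finite_res_pullback_mon bW bV ψ P η))
  map_add' η θ := by
    rw [← map_add]
    congr 1
    ext a
    simp [Finsupp.ofSupportFinite_coe]
  map_smul' c η := by
    rw [← map_smul]
    congr 1
    ext a
    simp [Finsupp.ofSupportFinite_coe, smul_comm _ c]

/-- On monomials this is the definition of `LC.map`, since by `res_mon_smul` the residues against
monomials are the coefficients; monomials span. -/
lemma LC.resMul_map (f : PolyFun k V) (η : LC bW P) :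
    LC.resMul bV (ψ P) f (LC.map bW bV ψ P η) = LC.resMul bW P (pullback ψ f) η := by
  have hf := mem_span_mon bV (ψ P) f
  induction hf using Submodule.span_induction with
  | mem f hf =>
    obtain ⟨a, rfl⟩ := hf
    rw [LC.resMul_apply, res_mon_smul]
    change (fracBasis bV (ψ P)).repr ((fracBasis bV (ψ P)).repr.symm _) a = _
    rw [LinearEquiv.apply_symm_apply]
    rfl
  | zero => simp [LC.resMul_apply]
  | add x y _ _ hx hy =>
    simp only [LC.resMul_apply, map_add, add_smul] at hx hy ⊢
    rw [hx, hy]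
  | smul c x _ hx =>
    simp only [LC.resMul_apply, map_smul, smul_assoc] at hx ⊢
    rw [hx]

/-! ### Compatibility with the vacuum, derivatives and kets -/

lemma LC.map_vacuum : LC.map bW bV ψ P (LC.vacuum bW P) = LC.vacuum bV (ψ P) := by
  refine LC.ext_res bV (ψ P) fun f => ?_
  rw [← LC.resMul_apply, LC.resMul_map, LC.resMul_apply, LC.res_smul_vacuum, LC.res_smul_vacuum,
    evalAt_pullback]

lemma LC.map_deriv (ν : W) (η : LC bW P) :
    LC.map bW bV ψ P (LC.deriv bW P ν η) = LC.deriv bV (ψ P) (ψ ν) (LC.map bW bV ψ P η) := by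
  refine LC.ext_res bV (ψ P) fun f => ?_
  rw [← LC.resMul_apply, LC.resMul_map, LC.resMul_apply, LC.res_smul_deriv, LC.res_smul_deriv,
    dirDeriv_pullback, ← LC.resMul_apply, ← LC.resMul_map, LC.resMul_apply]

lemma LC.map_ket {s : ℕ} (ν : Fin s → W) :
    LC.map bW bV ψ P (LC.ket bW P ν) = LC.ket bV (ψ P) (fun i => ψ (ν i)) := by
  -- A ket is a fold over a list, so the induction runs over arbitrary lists of vectors.
  have h : ∀ L : List W,
      LC.map bW bV ψ P (L.foldr (fun v η => LC.deriv bW P v η) (LC.vacuum bW P)) =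
      (L.map ψ).foldr (fun v η => LC.deriv bV (ψ P) v η) (LC.vacuum bV (ψ P)) := by
    intro L
    induction L with
    | nil => exact LC.map_vacuum bW bV ψ P
    | cons v L ih => rw [List.foldr_cons, LC.map_deriv, ih, List.map_cons, List.foldr_cons]
  rw [LC.ket, h, LC.ket, List.map_ofFn]
  rfl

/-! ### Compatibility with the coalgebra structures and dereliction -/

lemma LC.res_map (η : LC bW P) : res bV (ψ P) (LC.map bW bV ψ P η) = res bW P η := by
  have := LC.resMul_map bW bV ψ P 1 η
  rwa [map_one, LC.resMul_apply, LC.resMul_apply, one_smul, one_smul] at this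

/-- For monomials `f` and `g` these functionals are the coordinates in the tensor product basis. -/
lemma LC.tensor_ext {b : Basis (Fin n) k V} {Q : V} {x y : LC b Q ⊗[k] LC b Q}
    (h : ∀ f g, LinearMap.mul' k k (TensorProduct.map (LC.resMul b Q f) (LC.resMul b Q g) x) =
      LinearMap.mul' k k (TensorProduct.map (LC.resMul b Q f) (LC.resMul b Q g) y)) : x = y := by
  let B := (fracBasis b Q).tensorProduct (fracBasis b Q)
  have hB : ∀ c d, LinearMap.mul' k k ∘ₗ TensorProduct.map (LC.resMul b Q (mon b Q c))
      (LC.resMul b Q (mon b Q d)) = B.coord (c, d) := by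
    intro c d
    refine TensorProduct.ext' fun η θ => ?_
    simp only [LinearMap.comp_apply, TensorProduct.map_tmul, LinearMap.mul'_apply,
      LC.resMul_apply, res_mon_smul, B, Basis.coord_apply, Basis.tensorProduct_repr_tmul_apply,
      smul_eq_mul, mul_comm]
  refine B.repr.injective (Finsupp.ext fun ⟨c, d⟩ => ?_)
  rw [← Basis.coord_apply, ← Basis.coord_apply, ← hB]
  exact h _ _

/-- Paired with `f ⊗ g`, the two sides become the residues of `η` against `(f g) ∘ ψ` and `(f ∘ ψ)
(g ∘ ψ)`. -/
lemma LC.comul_map (η : LC bW P) : Coalgebra.comul (R := k) (LC.map bW bV ψ P η) =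
    TensorProduct.map (LC.map bW bV ψ P) (LC.map bW bV ψ P) (Coalgebra.comul (R := k) η) := by
  refine LC.tensor_ext fun f g => ?_
  have h : ∀ f, LC.resMul bV (ψ P) f ∘ₗ LC.map bW bV ψ P = LC.resMul bW P (pullback ψ f) :=
    fun f => LinearMap.ext (LC.resMul_map bW bV ψ P f)
  rw [LC.res_mul_smul, ← LC.resMul_apply, LC.resMul_map, map_mul, LC.resMul_apply,
    ← LC.res_mul_smul, ← h, ← h, TensorProduct.map_comp, LinearMap.comp_apply]

/-- The morphism of coalgebras `!ψ : !W ⟶ !V`. -/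
def Bang.map : Bang bW →ₗc[k] Bang bV where
  toLinearMap := Bang.lift bW fun P => Bang.incl bV (ψ P) ∘ₗ LC.map bW bV ψ P
  counit_comp := by
    refine Bang.hom_ext bW fun P => LinearMap.ext fun η => ?_
    simp only [LinearMap.comp_apply, Bang.lift_incl, Bang.counit_incl, LC.res_map]
  map_comp_comul := by
    refine Bang.hom_ext bW fun P => LinearMap.ext fun η => ?_
    rw [LinearMap.comp_assoc, LinearMap.comp_apply, LinearMap.comp_apply, Bang.comul_incl,
      LinearMap.comp_apply, LinearMap.comp_apply, Bang.lift_incl, LinearMap.comp_apply,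
      Bang.comul_incl, LC.comul_map, TensorProduct.map_map, TensorProduct.map_map,
      Bang.lift_comp_incl]

lemma Bang.map_incl (η : LC bW P) : Bang.map bW bV ψ (Bang.incl bW P η) =
    Bang.incl bV (ψ P) (LC.map bW bV ψ P η) :=
  Bang.lift_incl bW P _ η

lemma Bang.dereliction_comp_map : Bang.dereliction bV ∘ₗ (Bang.map bW bV ψ).toLinearMap =
    ψ ∘ₗ Bang.dereliction bW := by
  refine Bang.hom_ext bW fun P => LinearMap.ext fun η => ?_
  change Bang.dereliction bV (Bang.map bW bV ψ (Bang.incl bW P η)) =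
    ψ (Bang.dereliction bW (Bang.incl bW P η))
  rw [Bang.map_incl, Bang.dereliction_incl, Bang.dereliction_incl]
  refine bV.ext_elem fun i => ?_
  rw [← Basis.coord_apply, ← Basis.coord_apply, LC.coord_dereliction, LC.resMul_map,
    pullback_linForm, ← LC.coord_dereliction, LinearMap.comp_apply]

/-! ### Uniqueness, and the formula on kets -/

variable {bW bV ψ} in
/-- A morphism of coalgebras over `ψ` is the transpose of the composition with `ψ`. -/
lemma Bang.resMul_coalgHom {Φ : Bang bW →ₗc[k] Bang bV}
    (hΦ : Bang.dereliction bV ∘ₗ Φ.toLinearMap = ψ ∘ₗ Bang.dereliction bW) (f : PolyFun k V)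
    (x : Bang bW) : Bang.resMul bV f (Φ x) = Bang.resMul bW (pullback ψ f) x := by
  -- Constants are controlled by the counit, linear forms by the dereliction, products by the
  -- coproduct. The element `x` varies because the product case needs the hypotheses as equalities
  -- of functionals, to apply them to both tensor factors of the coproduct of `x`.
  induction f using SymmetricAlgebra.induction generalizing x with
  | algebraMap r =>
    rw [AlgHom.commutes, Bang.resMul_algebraMap, Bang.resMul_algebraMap,
      CoalgHomClass.counit_comp_apply]
  | ι l =>
    change Bang.resMul bV (linForm V l) (Φ x) = Bang.resMul bW (pullback ψ (linForm V l)) x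
    rw [pullback_linForm, Bang.resMul_linForm, Bang.resMul_linForm]
    exact congr(l ($hΦ x))
  | mul f g hf hg =>
    have hf' : Bang.resMul bV f ∘ₗ (Φ : Bang bW →ₗ[k] Bang bV) = Bang.resMul bW (pullback ψ f) :=
      LinearMap.ext hf
    have hg' : Bang.resMul bV g ∘ₗ (Φ : Bang bW →ₗ[k] Bang bV) = Bang.resMul bW (pullback ψ g) :=
      LinearMap.ext hg
    rw [map_mul, Bang.resMul_mul, Bang.resMul_mul, ← CoalgHomClass.map_comp_comul_apply, ← hf',
      ← hg', TensorProduct.map_comp, LinearMap.comp_apply]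
  | add f g hf hg =>
    rw [map_add, Bang.resMul_add, Bang.resMul_add, LinearMap.add_apply, LinearMap.add_apply, hf,
      hg]

variable {bW bV ψ} in
lemma Bang.eq_map {Φ : Bang bW →ₗc[k] Bang bV}
    (hΦ : Bang.dereliction bV ∘ₗ Φ.toLinearMap = ψ ∘ₗ Bang.dereliction bW) :
    Φ = Bang.map bW bV ψ :=
  CoalgHom.ext fun x => Bang.ext_resMul bV fun f => by
    rw [Bang.resMul_coalgHom hΦ, Bang.resMul_coalgHom (Bang.dereliction_comp_map bW bV ψ)]

lemma Bang.map_ket {s : ℕ} (ν : Fin s → W) :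
    Bang.map bW bV ψ (Bang.ket bW P ν) = Bang.ket bV (ψ P) (fun i => ψ (ν i)) := by
  rw [Bang.ket, Bang.map_incl, LC.map_ket, Bang.ket]

end Sweedler

end

theorem corollary2p17 {k : Type*} [Field k] [IsAlgClosed k] [CharZero k]
    {W V : Type*} [AddCommGroup W] [Module k W] [AddCommGroup V] [Module k V]
    {m n : ℕ} (bW : Basis (Fin m) k W) (bV : Basis (Fin n) k V) (ψ : W →ₗ[k] V) :
    (∃! Φ : Sweedler.Bang bW →ₗc[k] Sweedler.Bang bV,
      Sweedler.Bang.dereliction bV ∘ₗ Φ.toLinearMap = ψ ∘ₗ Sweedler.Bang.dereliction bW) ∧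
    ∀ Φ : Sweedler.Bang bW →ₗc[k] Sweedler.Bang bV,
      Sweedler.Bang.dereliction bV ∘ₗ Φ.toLinearMap = ψ ∘ₗ Sweedler.Bang.dereliction bW →
      ∀ (P : W) (s : ℕ) (ν : Fin s → W),
        Φ (Sweedler.Bang.ket bW P ν) = Sweedler.Bang.ket bV (ψ P) (fun i => ψ (ν i)) := by
  refine ⟨⟨Sweedler.Bang.map bW bV ψ, Sweedler.Bang.dereliction_comp_map bW bV ψ,
    fun Φ hΦ => Sweedler.Bang.eq_map hΦ⟩, fun Φ hΦ P s ν => ?_⟩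
  rw [Sweedler.Bang.eq_map hΦ, Sweedler.Bang.map_ket]
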